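/- **Setting.** Let $(\Omega,\mathscr F,\mathcal P)$ be a probability space, $M,N\in\mathbb N$, $a<b$, $\mathcal Z=[a,b]^M$. *State.* $X_{-1},X_0,X_1,\dots$ are $\mathbb R^M$-valued random variables that lie in $\mathcal Z$ almost surely. One of the following is assumed. (i) $(X_t)_{t\ge -1}$ is a Markov process with transition kernels $\mathcal K_t$ ($t\ge 0$). (ii) $X_t=f_t(X_{t-1},W_t)$ almost surely for all $t\ge0$, where $(W_t)_{t\ge 0}$ is an i.i.d. sequence in $\mathcal W\subseteq\mathbb R^{M_W}$ independent of $X_{-1}$, the maps $f_t$ are measurable, for each $x\in\mathcal Z$ almost surely $f_t(x,W_t)\in\mathcal Z$, and for every $w\in\mathcal W$ and $t\ge 0$, $\|f_t(x_1,w)-f_t(x_2,w)\|_1\le K_t(w)\|x_1-x_2\|_1$ for all $x_1,x_2\in\mathcal Z$, with $K_t\ge 0$ and $\sup_{w\in\mathcal W}K_t(w)<\infty$. *Observations.* $y_0,y_1,\dots$ are $\mathbb R^N$-valued and, conditionally on the whole state process in case (i), respectively on $X_{-1}$ and $(W_t)_{t\ge0}$ in case (ii), independent with $y_t\sim\mathcal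 N(\mu_t(X_t),C_t(X_t))$, where $C_t(x)=\Sigma_t(x)+\sigma^2 I$, $\sigma\ge0$, and $\Sigma_t(x)$ is symmetric positive definite for $x\in\mathcal Z$. The eigenvalues of $C_t(x)$ and the norms $\|\mu_t(x)\|_2$ are bounded above uniformly in $t\ge0$, $x\in\mathcal Z$; the infimum of the eigenvalues of $C_t(x)$ over $t\ge 0$, $x\in\mathcal Z$ is greater than $1$; and $\mu_t$ and all entries of $\Sigma_t$ are Lipschitz on $\mathcal Z$ with respect to the $\ell_1$-norm, with constants independent of $t$. *Quantization.* For $L\ge1$ let $\mathcal Q_L:\mathcal Z\to\mathcal Z$ be the quantizer with $L^M$ levels obtained from a partition of $[a,b]$ into $L$ intervals of equal length: it maps every point of a product of $M$ of these intervals to the centre of that box. The marginal quantization is $X^L_t=\mathcal Q_L(X_t)$. The Markovian quantization (case (ii)) is $X^L_t=\mathcal Q_L(f_t(X^L_{t-1},W_t))$ for $t\ge0$, with $X^L_{-1}=\mathcal Q_L(X_{-1})$. *Filters.* Let $\mathscr Y_t$ be the $\sigma$-algebra generated by $y_0,\dots,y_t$ and the null events, let $\mathcal N(\cdot\,;m,C)$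 denote the Gaussian density on $\mathbb R^N$, and put $\mathsf L_t(x,y)=(\sqrt{2\pi})^N\mathcal N(y;\mu_t(x),C_t(x))$ and $\Lambda^L_t=\prod_{i=0}^t\mathsf L_i(X^L_i,y_i)$. Let $\widetilde{\mathcal P}$ be the reference measure, given for events up to time $t$ by $$\frac{d\widetilde{\mathcal P}}{d\mathcal P}=\prod_{i=0}^t\frac{\mathcal N(y_i;0,I)}{\mathcal N(y_i;\mu_i(X_i),C_i(X_i))}.$$ The approximate filter is $$\mathcal E^{L}(X_t|\mathscr Y_t)=\frac{\mathbb E_{\widetilde{\mathcal P}}\{X^L_t\Lambda^L_t\,|\,\mathscr Y_t\}}{\mathbb E_{\widetilde{\mathcal P}}\{\Lambda^L_t\,|\,\mathscr Y_t\}}.$$ **Theorem (Convergence of Approximate Filters).** Let $T\in\mathbb N$, and let $X^L_t$ be either the marginal quantization of the state, under (i), or the Markovian quantization of the state, under (ii). Then for every finite constant $C\ge1$ there is a measurable set $\widehat\Omega_T\subseteq\Omega$ with $$\mathcal P(\widehat\Omega_T)\ \ge\ 1-(T+1)^{1-CN}\exp(-CN)$$ such that $$\lim_{L\to\infty}\ \sup_{0\le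 t\le T}\ \sup_{\omega\in\widehat\Omega_T}\bigl\|\mathcal E^{L}(X_t|\mathscr Y_t)-\mathbb E_{\mathcal P}\{X_t|\mathscr Y_t\}\bigr\|_1(\omega)=0 .$$ -/

import Mathlib

open MeasureTheory ProbabilityTheory Filter Topology
open scoped ENNReal

noncomputable section

namespace GridFilter

/-- Column vectors `ℝⁿ`. -/
abbrev Vec (n : ℕ) : Type := EuclideanSpace ℝ (Fin n)

/-- The `ℓ₁`-norm of a vector. -/
def l1Norm {n : ℕ} (x : Vec n) : ℝ := ∑ i, |x i|

/-- The state domain `[a, b]^M`. -/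
def stateCube (M : ℕ) (a b : ℝ) : Set (Vec M) := {x | ∀ m, x m ∈ Set.Icc a b}

/-! ### Uniform quantization of the state domain -/

/-- A partition of `[a, b]` into `L` consecutive intervals of equal length.  Each common endpoint
of two neighbouring intervals may be attached to either of them. -/
structure IsUniformPartition (a b : ℝ) (L : ℕ) (cell : Fin L → Set ℝ) : Prop where
  pairwise_disjoint : Pairwise (Function.onFun Disjoint cell)
  cover : (⋃ l, cell l) = Set.Icc a b
  interior_subset : ∀ l : Fin L,
    Set.Ioo (a + (l : ℝ) * (b - a) / L) (a + ((l : ℝ) + 1) * (b - a) / L) ⊆ cell l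
  subset_closure : ∀ l : Fin L,
    cell l ⊆ Set.Icc (a + (l : ℝ) * (b - a) / L) (a + ((l : ℝ) + 1) * (b - a) / L)

/-- The centre of the `l`-th interval of the uniform partition. -/
def cellCenter (a b : ℝ) (L : ℕ) (l : Fin L) : ℝ := a + ((l : ℝ) + 1 / 2) * (b - a) / L

/-- The quantizer of `[a, b]^M` with `L^M` levels: a point of the box `∏ₘ cell (lₘ)` is sent to the
centre of that box.  (Of each sum over `l` at most one term is present.) -/
def quantizer {M : ℕ} (a b : ℝ) {L : ℕ} (cell : Fin L → Set ℝ) (x : Vec M) : Vec M :=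
  WithLp.toLp 2 fun m => ∑ l, (cell l).indicator (fun _ => cellCenter a b L l) (x m)

variable {Ω : Type*}

/-- The state preceding time `t`, with `Xinit` the state at time `-1`. -/
def prevState {M : ℕ} (Xinit : Ω → Vec M) (X : ℕ → Ω → Vec M) : ℕ → Ω → Vec M
  | 0 => Xinit
  | t + 1 => X t

/-- Marginal quantization of the state at the times `t ≥ 0`, for the quantizer `q`. -/
def marginalQuantization {M : ℕ} (q : Vec M → Vec M) (X : ℕ → Ω → Vec M) : ℕ → Ω → Vec M :=
  fun t ω => q (X t ω)

/-- Markovian quantization of the state at the times `t ≥ 0`, for the quantizer `q`: the transition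
recursion with every value quantized, started at time `-1` from `q (Xinit)`. -/
def markovianQuantization {M MW : ℕ} (q : Vec M → Vec M) (f : ℕ → Vec M → Vec MW → Vec M)
    (Xinit : Ω → Vec M) (W : ℕ → Ω → Vec MW) : ℕ → Ω → Vec M
  | 0 => fun ω => q (f 0 (q (Xinit ω)) (W 0 ω))
  | t + 1 => fun ω => q (f (t + 1) (markovianQuantization q f Xinit W t ω) (W (t + 1) ω))

/-! ### Observations -/

/-- The data of conditionally Gaussian observations in `ℝᴺ`: at time `t`, given the state `x`, the
mean is `mean t x` and the covariance matrix is `Sig t x + sigma² I`. -/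
structure ObservationModel (M N : ℕ) where
  mean : ℕ → Vec M → Vec N
  Sig : ℕ → Vec M → Matrix (Fin N) (Fin N) ℝ
  sigma : ℝ

/-- The conditional covariance matrix `C_t(x) = Σ_t(x) + σ² I`. -/
def ObservationModel.cov {M N : ℕ} (O : ObservationModel M N) (t : ℕ) (x : Vec M) :
    Matrix (Fin N) (Fin N) ℝ :=
  O.Sig t x + O.sigma ^ 2 • (1 : Matrix (Fin N) (Fin N) ℝ)

/-- The standing assumptions on the observations, on the state domain `Z`: positive definiteness,
boundedness (uniform in time and state) and Lipschitz continuity in the `ℓ₁`-norm (uniform in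
time). The spectrum of a symmetric matrix is its set of eigenvalues. -/
structure ObservationModel.IsRegular {M N : ℕ} (O : ObservationModel M N) (Z : Set (Vec M)) :
    Prop where
  sigma_nonneg : 0 ≤ O.sigma
  posDef : ∀ t, ∀ x ∈ Z, (O.Sig t x).PosDef
  eigenvalue_le : ∃ lamSup : ℝ, ∀ t, ∀ x ∈ Z, ∀ e ∈ spectrum ℝ (O.cov t x), e ≤ lamSup
  one_lt_eigenvalue : ∃ lamInf : ℝ, 1 < lamInf ∧
    ∀ t, ∀ x ∈ Z, ∀ e ∈ spectrum ℝ (O.cov t x), lamInf ≤ e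
  mean_bounded : ∃ muSup : ℝ, ∀ t, ∀ x ∈ Z, ‖O.mean t x‖ ≤ muSup
  mean_lipschitz : ∃ K : ℝ, ∀ t, ∀ x₁ ∈ Z, ∀ x₂ ∈ Z,
    l1Norm (O.mean t x₁ - O.mean t x₂) ≤ K * l1Norm (x₁ - x₂)
  Sig_lipschitz : ∃ K : ℝ, ∀ t, ∀ x₁ ∈ Z, ∀ x₂ ∈ Z, ∀ i j,
    |O.Sig t x₁ i j - O.Sig t x₂ i j| ≤ K * l1Norm (x₁ - x₂)

/-- The Gaussian density `𝒩(y; m, C)` on `ℝᴺ`. -/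
def gaussianDensity {N : ℕ} (m : Vec N) (C : Matrix (Fin N) (Fin N) ℝ) (y : Vec N) : ℝ :=
  (√(2 * Real.pi) ^ N)⁻¹ * (√C.det)⁻¹ *
    Real.exp (-(1 / 2) * ((y - m).ofLp ⬝ᵥ C⁻¹.mulVec (y - m).ofLp))

/-- The likelihood `𝖫_t(x, y) = (√(2π))ᴺ 𝒩(y; μ_t(x), C_t(x))`. -/
def likelihood {M N : ℕ} (O : ObservationModel M N) (t : ℕ) (x : Vec M) (y : Vec N) : ℝ :=
  √(2 * Real.pi) ^ N * gaussianDensity (O.mean t x) (O.cov t x) y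

/-- The likelihood process `Λ_t = ∏_{i ≤ t} 𝖫_i(X_i, y_i)`. -/
def likelihoodProcess {M N : ℕ} (O : ObservationModel M N) (X : ℕ → Ω → Vec M)
    (y : ℕ → Ω → Vec N) (t : ℕ) (ω : Ω) : ℝ :=
  ∏ i ∈ Finset.range (t + 1), likelihood O i (X i ω) (y i ω)

variable [MeasurableSpace Ω]

/-- Given the σ-algebra `𝒢` (which carries the whole state process), the observations are
independent with `y_t ∼ 𝒩(μ_t(X_t), C_t(X_t))`. -/
def IsConditionallyGaussian {M N : ℕ} (P : Measure Ω) (O : ObservationModel M N)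
    (𝒢 : MeasurableSpace Ω) (X : ℕ → Ω → Vec M) (y : ℕ → Ω → Vec N) : Prop :=
  ∀ (n : ℕ) (A : ℕ → Set (Vec N)), (∀ i, MeasurableSet (A i)) →
    P⟦⋂ i ∈ Finset.range n, y i ⁻¹' A i | 𝒢⟧ =ᵐ[P] fun ω =>
      ∏ i ∈ Finset.range n,
        (multivariateGaussian (O.mean i (X i ω)) (O.cov i (X i ω))).real (A i)

/-! ### The two descriptions of the partially observed system -/

/-- Partially observed Markov state `X` with initial value `Xinit` (time `-1`) and transition
kernels `K t` from time `t - 1` to time `t`, living almost surely in `Z`, with conditionally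
Gaussian observations `y`. -/
structure IsHiddenMarkovModel {M N : ℕ} (P : Measure Ω) (Z : Set (Vec M))
    (O : ObservationModel M N) (K : ℕ → Kernel (Vec M) (Vec M)) (Xinit : Ω → Vec M)
    (X : ℕ → Ω → Vec M) (y : ℕ → Ω → Vec N) : Prop where
  measurable_init : Measurable Xinit
  measurable_state : ∀ t, Measurable (X t)
  measurable_obs : ∀ t, Measurable (y t)
  init_mem : ∀ᵐ ω ∂P, Xinit ω ∈ Z
  state_mem : ∀ t, ∀ᵐ ω ∂P, X t ω ∈ Z
  markov : ∀ (t : ℕ) (A : Set (Vec M)), MeasurableSet A →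
    P⟦X t ⁻¹' A | MeasurableSpace.comap Xinit inferInstance ⊔
        ⨆ (i : ℕ) (_ : i < t), MeasurableSpace.comap (X i) inferInstance⟧
      =ᵐ[P] fun ω => (K t (prevState Xinit X t ω)).real A
  observation : IsConditionallyGaussian P O
    (MeasurableSpace.comap Xinit inferInstance ⊔
      ⨆ i : ℕ, MeasurableSpace.comap (X i) inferInstance) X y

/-- Partially observed state `X` driven by the transition mappings `f t` and the white noise `W`
with state space `𝒲`, that is `X_t = f_t(X_{t-1}, W_t)` with `X_{-1} = Xinit` independent of `W`,
living almost surely in `Z`, with conditionally Gaussian observations `y` whose noise is independent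
of `Xinit` and `W`. -/
structure IsStateSpaceModel {M MW N : ℕ} (P : Measure Ω) (Z : Set (Vec M)) (𝒲 : Set (Vec MW))
    (O : ObservationModel M N) (f : ℕ → Vec M → Vec MW → Vec M) (Xinit : Ω → Vec M)
    (W : ℕ → Ω → Vec MW) (X : ℕ → Ω → Vec M) (y : ℕ → Ω → Vec N) : Prop where
  measurable_init : Measurable Xinit
  measurable_noise : ∀ t, Measurable (W t)
  measurable_state : ∀ t, Measurable (X t)
  measurable_obs : ∀ t, Measurable (y t)
  measurable_transition : ∀ t, Measurable fun p : Vec M × Vec MW => f t p.1 p.2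
  noise_mem : ∀ t, ∀ᵐ ω ∂P, W t ω ∈ 𝒲
  noise_independent : iIndepFun W P
  noise_identDistrib : ∀ t, IdentDistrib (W t) (W 0) P P
  init_independent_noise : IndepFun Xinit (fun ω t => W t ω) P
  transition_mem : ∀ t, ∀ x ∈ Z, ∀ᵐ ω ∂P, f t x (W t ω) ∈ Z
  recursion : ∀ t, ∀ᵐ ω ∂P, X t ω = f t (prevState Xinit X t ω) (W t ω)
  init_mem : ∀ᵐ ω ∂P, Xinit ω ∈ Z
  state_mem : ∀ t, ∀ᵐ ω ∂P, X t ω ∈ Z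
  observation : IsConditionallyGaussian P O
    (MeasurableSpace.comap Xinit inferInstance ⊔
      ⨆ i : ℕ, MeasurableSpace.comap (W i) inferInstance) X y

/-- Lipschitz transition mappings: for each noise value `w`, the map `x ↦ f_t(x, w)` is Lipschitz on
`Z` in the `ℓ₁`-norm with a constant `K_t(w)` for which `sup_w K_t(w)` is finite. -/
def IsLipschitzTransition {M MW : ℕ} (Z : Set (Vec M)) (𝒲 : Set (Vec MW))
    (f : ℕ → Vec M → Vec MW → Vec M) : Prop :=
  ∃ K : ℕ → Vec MW → ℝ, ∀ t, BddAbove (K t '' 𝒲) ∧ ∀ w ∈ 𝒲, 0 ≤ K t w ∧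
    ∀ x₁ ∈ Z, ∀ x₂ ∈ Z, l1Norm (f t x₁ w - f t x₂ w) ≤ K t w * l1Norm (x₁ - x₂)

/-! ### True and approximate filters -/

/-- The σ-algebra `𝒴_t` of the observations up to time `t`, augmented by the null events. -/
abbrev observationSigma {N : ℕ} (P : Measure Ω) (y : ℕ → Ω → Vec N) (t : ℕ) : MeasurableSpace Ω :=
  (⨆ (i : ℕ) (_ : i ≤ t), MeasurableSpace.comap (y i) inferInstance) ⊔
    MeasurableSpace.generateFrom {s | MeasurableSet s ∧ P s = 0}

/-- The true filter `𝔼_P{X_t | 𝒴_t}`. -/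
def trueFilter {M N : ℕ} (P : Measure Ω) (X : ℕ → Ω → Vec M) (y : ℕ → Ω → Vec N) (t : ℕ) :
    Ω → Vec M :=
  P[X t | observationSigma P y t]

/-- The reference measure `P̃` of the change of measure, for the events up to time `t`:
`dP̃/dP = ∏_{i ≤ t} 𝒩(y_i; 0, I) / 𝒩(y_i; μ_i(X_i), C_i(X_i))`.  These measures are consistent in
`t`: on the events generated by the states, the noise and the observations up to time `t`, those
with a larger index agree with this one. -/
def refMeasure {M N : ℕ} (P : Measure Ω) (O : ObservationModel M N) (X : ℕ → Ω → Vec M)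
    (y : ℕ → Ω → Vec N) (t : ℕ) : Measure Ω :=
  P.withDensity fun ω => ENNReal.ofReal (∏ i ∈ Finset.range (t + 1),
    gaussianDensity 0 1 (y i ω) / gaussianDensity (O.mean i (X i ω)) (O.cov i (X i ω)) (y i ω))

/-- The approximate filter of the state `X` built from the approximation `XL` of `X`:
`𝔼_P̃{XL_t Λ_t(XL) | 𝒴_t} / 𝔼_P̃{Λ_t(XL) | 𝒴_t}`. -/
def approxFilter {M N : ℕ} (P : Measure Ω) (O : ObservationModel M N) (X : ℕ → Ω → Vec M)
    (y : ℕ → Ω → Vec N) (XL : ℕ → Ω → Vec M) (t : ℕ) : Ω → Vec M := fun ω =>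
  (((refMeasure P O X y t)[likelihoodProcess O XL y t | observationSigma P y t]) ω)⁻¹ •
    ((refMeasure P O X y t)[fun ω' => likelihoodProcess O XL y t ω' • XL t ω' |
      observationSigma P y t]) ω

/-- Convergence on the horizon `{0, …, T}`: for every finite constant `C ≥ 1` there is an event of
probability at least `1 - (T+1)^(1-CN) exp(-CN)` on which the approximate filters built from the
approximations `XL L` converge to the true filter as `L → ∞`, uniformly in time and outcome. -/
def FilterConvergence {M N : ℕ} (P : Measure Ω) (O : ObservationModel M N) (X : ℕ → Ω → Vec M)
    (y : ℕ → Ω → Vec N) (XL : ℕ → ℕ → Ω → Vec M) (T : ℕ) : Prop :=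
  ∀ C : ℝ, 1 ≤ C → ∃ Ωhat : Set Ω, MeasurableSet Ωhat ∧
    ENNReal.ofReal (1 - ((T : ℝ) + 1) ^ (1 - C * (N : ℝ)) * Real.exp (-(C * (N : ℝ)))) ≤ P Ωhat ∧
    Tendsto (fun L : ℕ => ⨆ (t : ℕ) (_ : t ≤ T) (ω : Ω) (_ : ω ∈ Ωhat),
      ENNReal.ofReal (l1Norm (approxFilter P O X y (XL L) t ω - trueFilter P X y t ω)))
      atTop (𝓝 0)

end GridFilter

end

/-! The probability bound has the form `1 - ε` with a fixed `ε > 0`, so by Egorov's theorem it is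
enough that the approximate filters converge almost surely at each time `t ≤ T`
(`filterConvergence_of_ae_tendsto`).

For almost sure convergence, let `d` be the density of the reference measure and `Λ` the likelihood
process of the true state. In the product `d * Λ` the state-dependent factors cancel and a function
of the observations remains. This yields Bayes' formula: the true filter is the quotient of the
reference conditional expectations of `Λ X` and `Λ`. Dominated convergence for conditional
expectations then passes to the limit in numerator and denominator
(`tendsto_ae_condExp_quotient_of_withDensity`).

Two Gaussian estimates supply the domination. Eigenvalues at least 1 make every likelihood at most
1, and a lower bound strictly above 1 makes `d` bounded, so that the reference measure is finite.
The quantized states converge almost surely because the quantization error is `O(1/L)`; in the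
Markovian case the error is propagated pathwise through the Lipschitz transitions. -/

namespace GridFilter

/-! ### Integration against a real-valued density -/

section WithDensity

variable {α E : Type*} [MeasurableSpace α] {μ : Measure α} [NormedAddCommGroup E]
  [NormedSpace ℝ E] {d : α → ℝ}

theorem integrable_withDensity_ofReal_iff (hd : AEMeasurable d μ) (hd0 : ∀ᵐ x ∂μ, 0 ≤ d x)
    (f : α → E) : Integrable f (μ.withDensity fun x => ENNReal.ofReal (d x)) ↔
      Integrable (fun x => d x • f x) μ := by
  rw [integrable_withDensity_iff_integrable_smul₀' hd.ennreal_ofReal (by simp)]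
  refine integrable_congr ?_
  filter_upwards [hd0] with x hx
  rw [ENNReal.toReal_ofReal hx]

theorem setIntegral_withDensity_ofReal (hd : AEMeasurable d μ) (hd0 : ∀ᵐ x ∂μ, 0 ≤ d x)
    (f : α → E) {s : Set α} (hs : MeasurableSet s) :
    ∫ x in s, f x ∂(μ.withDensity fun x => ENNReal.ofReal (d x)) = ∫ x in s, d x • f x ∂μ := by
  rw [setIntegral_withDensity_eq_setIntegral_toReal_smul₀ hd.ennreal_ofReal.restrict (by simp) f hs]
  refine integral_congr_ae (ae_restrict_of_ae ?_)
  filter_upwards [hd0] with x hx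
  rw [ENNReal.toReal_ofReal hx]

end WithDensity

/-! ### Conditional dominated convergence and Bayes' formula -/

section ConditionalExpectation

variable {α E : Type*} {m m₀ : MeasurableSpace α} {μ : Measure α}
  [NormedAddCommGroup E] [NormedSpace ℝ E] [CompleteSpace E]

/-- **Dominated convergence theorem** for conditional expectations, in almost everywhere form. -/
theorem tendsto_ae_condExp_of_dominated (hm : m ≤ m₀) [SigmaFinite (μ.trim hm)]
    {f : ℕ → α → E} {g : α → E} {bound : α → ℝ}
    (hf : ∀ n, AEStronglyMeasurable (f n) μ) (hbound : Integrable bound μ)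
    (hfb : ∀ n, ∀ᵐ x ∂μ, ‖f n x‖ ≤ bound x)
    (hlim : ∀ᵐ x ∂μ, Tendsto (fun n => f n x) atTop (𝓝 (g x))) :
    ∀ᵐ x ∂μ, Tendsto (fun n => (μ[f n | m]) x) atTop (𝓝 ((μ[g | m]) x)) := by
  have hfb' := ae_all_iff.2 hfb
  have hg : AEStronglyMeasurable g μ := aestronglyMeasurable_of_tendsto_ae _ hf hlim
  have hgb : ∀ᵐ x ∂μ, ‖g x‖ ≤ bound x := by
    filter_upwards [hfb', hlim] with x hx hl
    exact le_of_tendsto' hl.norm hx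
  have hfi : ∀ n, Integrable (f n) μ := fun n => hbound.mono' (hf n) (hfb n)
  have hgi : Integrable g μ := hbound.mono' hg hgb
  have hdiff : ∀ᵐ x ∂μ, ∀ n, ‖f n x - g x‖ ≤ 2 * bound x := by
    filter_upwards [hfb', hgb] with x hx hxg n
    linarith [norm_sub_le (f n x) (g x), hx n]
  have hbdd : ∀ᵐ x ∂μ, ∀ k, BddAbove (Set.range fun n => ‖f (n + k) x - g x‖) := by
    filter_upwards [hdiff] with x hx k
    exact ⟨2 * bound x, by rintro _ ⟨n, rfl⟩; exact hx _⟩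
  -- The tail suprema of the errors decrease in `k`, are dominated by `2 * bound` and tend to 0.
  -- Monotonicity passes to their conditional expectations, which the errors themselves would not
  -- provide.
  let h : ℕ → α → ℝ := fun k x => ⨆ n, ‖f (n + k) x - g x‖
  have h_nonneg : ∀ k x, 0 ≤ h k x := fun k x => Real.iSup_nonneg fun n => norm_nonneg _
  have h_le : ∀ᵐ x ∂μ, ∀ k, h k x ≤ 2 * bound x := by
    filter_upwards [hdiff] with x hx k
    exact ciSup_le fun n => hx _
  have le_h : ∀ᵐ x ∂μ, ∀ k, ‖f k x - g x‖ ≤ h k x := by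
    filter_upwards [hbdd] with x hx k
    simpa using le_ciSup (hx k) 0
  have h_anti : ∀ᵐ x ∂μ, ∀ k, h (k + 1) x ≤ h k x := by
    filter_upwards [hbdd] with x hx k
    refine ciSup_le fun n => ?_
    have := le_ciSup (hx k) (n + 1)
    rwa [show n + 1 + k = n + (k + 1) by ring] at this
  have h_meas : ∀ k, AEStronglyMeasurable (h k) μ := fun k =>
    (AEMeasurable.iSup fun n => ((hf (n + k)).sub hg).norm.aemeasurable).aestronglyMeasurable
  have h_int : ∀ k, Integrable (h k) μ := fun k => by
    refine (hbound.const_mul 2).mono' (h_meas k) ?_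
    filter_upwards [h_le] with x hx
    rw [Real.norm_of_nonneg (h_nonneg k x)]
    exact hx k
  have h_lim : ∀ᵐ x ∂μ, Tendsto (fun k => h k x) atTop (𝓝 0) := by
    filter_upwards [hlim] with x hx
    rw [tendsto_iff_norm_sub_tendsto_zero] at hx
    rw [Metric.tendsto_atTop] at hx ⊢
    intro ε hε
    obtain ⟨N, hN⟩ := hx (ε / 2) (half_pos hε)
    refine ⟨N, fun k hk => ?_⟩
    rw [Real.dist_0_eq_abs, abs_of_nonneg (h_nonneg k x)]
    refine lt_of_le_of_lt (ciSup_le fun n => ?_) (half_lt_self hε)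
    have := hN (n + k) (by omega)
    rw [Real.dist_0_eq_abs, abs_of_nonneg (norm_nonneg _)] at this
    exact this.le
  -- For a decreasing nonnegative sequence, integrals tending to 0 force almost everywhere
  -- convergence to 0.
  have key : ∀ᵐ x ∂μ, Tendsto (fun k => (μ[h k | m]) x) atTop (𝓝 ((0 : α → ℝ) x)) := by
    refine tendsto_of_integral_tendsto_of_antitone (fun _ => integrable_condExp)
      (integrable_zero _ _ _) ?_ ?_ ?_
    · simp only [integral_condExp hm]
      refine tendsto_integral_of_dominated_convergence (fun x => 2 * bound x) h_meas
        (hbound.const_mul 2) (fun k => ?_) h_lim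
      filter_upwards [h_le] with x hx
      rw [Real.norm_of_nonneg (h_nonneg k x)]
      exact hx k
    · have : ∀ k, μ[h (k + 1) | m] ≤ᵐ[μ] μ[h k | m] := fun k =>
        condExp_mono (h_int _) (h_int _) (h_anti.mono fun x hx => hx k)
      filter_upwards [ae_all_iff.2 this] with x hx
      exact antitone_nat_of_succ_le hx
    · exact ae_all_iff.2 fun k => condExp_nonneg (ae_of_all _ (h_nonneg k))
  have hle : ∀ᵐ x ∂μ, ∀ n, ‖(μ[f n | m]) x - (μ[g | m]) x‖ ≤ (μ[h n | m]) x := by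
    refine ae_all_iff.2 fun n => ?_
    have h1 : μ[fun x => ‖(f n - g) x‖ | m] ≤ᵐ[μ] μ[h n | m] :=
      condExp_mono ((hfi n).sub hgi).norm (h_int n) (le_h.mono fun x hx => hx n)
    filter_upwards [condExp_sub (hfi n) hgi m, norm_condExp_le (μ := μ) (m := m) (f n - g), h1]
      with x hx1 hx2 hx3
    rw [hx1] at hx2
    exact hx2.trans hx3
  filter_upwards [key, hle] with x hx hx'
  rw [tendsto_iff_norm_sub_tendsto_zero]
  exact squeeze_zero (fun _ => norm_nonneg _) hx' hx

/-- The conditional expectation of an almost everywhere positive function is almost everywhere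
positive. -/
theorem condExp_pos_of_pos (hm : m ≤ m₀) [SigmaFinite (μ.trim hm)] {f : α → ℝ}
    (hf : Integrable f μ) (hpos : ∀ᵐ x ∂μ, 0 < f x) : ∀ᵐ x ∂μ, 0 < (μ[f | m]) x := by
  -- `A` is `m`-measurable, so `f` has nonpositive integral over it; as `f` is positive almost
  -- everywhere, `A` must be null.
  set A : Set α := {x | (μ[f | m]) x ≤ 0}
  have hA : MeasurableSet[m] A :=
    (stronglyMeasurable_condExp (μ := μ) (m := m) (f := f)).measurable measurableSet_Iic
  have h1 : ∫ x in A, f x ∂μ ≤ 0 := by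
    rw [← setIntegral_condExp hm hf hA]
    exact setIntegral_nonpos (hm _ hA) fun x hx => hx
  have h2 : f =ᵐ[μ.restrict A] 0 := by
    have h0 : 0 ≤ᵐ[μ.restrict A] f := ae_restrict_of_ae (hpos.mono fun x hx => hx.le)
    exact (integral_eq_zero_iff_of_nonneg_ae h0 hf.integrableOn).1
      (le_antisymm h1 (integral_nonneg_of_ae h0))
  have h3 : ∀ᵐ x ∂μ, x ∈ A → f x = 0 := (ae_restrict_iff' (hm _ hA)).1 h2
  filter_upwards [h3, hpos] with x hx hx'
  by_contra hcon
  exact hx'.ne' (hx (not_lt.1 hcon))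

variable [IsFiniteMeasure μ] {d Λ ρ : α → ℝ} {X : α → E}

/-- **Bayes' formula**: if the density `d` of a change of measure and the likelihood `Λ` have an
`m`-measurable product `ρ`, then the conditional expectation of `X` is the quotient of the
conditional expectations of `Λ X` and `Λ` under the new measure. -/
theorem condExp_smul_eq_smul_condExp_of_withDensity (hm : m ≤ m₀)
    (hd : Integrable d μ) (hd0 : ∀ᵐ x ∂μ, 0 < d x)
    (hρ : StronglyMeasurable[m] ρ) {c : ℝ} (hρc : ∀ x, ‖ρ x‖ ≤ c)
    (hdΛ : ∀ᵐ x ∂μ, d x * Λ x = ρ x) (hX : Integrable X μ) :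
    (μ.withDensity fun x => ENNReal.ofReal (d x))[fun x => Λ x • X x | m]
      =ᵐ[μ.withDensity fun x => ENNReal.ofReal (d x)] fun x =>
        ((μ.withDensity fun x => ENNReal.ofReal (d x))[Λ | m]) x • (μ[X | m]) x := by
  have hd0' : ∀ᵐ x ∂μ, 0 ≤ d x := hd0.mono fun x hx => hx.le
  have hdm := hd.1.aemeasurable
  set ν := μ.withDensity fun x => ENNReal.ofReal (d x) with hν
  have : IsFiniteMeasure ν := isFiniteMeasure_withDensity_ofReal hd.2
  have hρm : AEStronglyMeasurable ρ μ := (hρ.mono hm).aestronglyMeasurable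
  have smul_ρ : ∀ Y : α → E, (fun x => d x • Λ x • Y x) =ᵐ[μ] fun x => ρ x • Y x := fun Y => by
    filter_upwards [hdΛ] with x hx
    rw [smul_smul, hx]
  have int_ρ : ∀ Y : α → E, Integrable Y μ → Integrable (fun x => ρ x • Y x) μ := fun Y hY =>
    hY.bdd_smul c hρm (ae_of_all _ hρc)
  have int_Λ : ∀ Y : α → E, Integrable Y μ → Integrable (fun x => Λ x • Y x) ν := fun Y hY => by
    rw [hν, integrable_withDensity_ofReal_iff hdm hd0', integrable_congr (smul_ρ Y)]
    exact int_ρ Y hY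
  have hΛi : Integrable Λ ν := by
    rw [hν, integrable_withDensity_ofReal_iff hdm hd0']
    refine Integrable.congr (f := ρ) ?_ (hdΛ.mono fun x hx => hx.symm)
    exact Integrable.of_bound hρm c (ae_of_all _ hρc)
  have hcond : Integrable (μ[X | m]) μ := integrable_condExp
  -- On an `m`-measurable set, integrating `Λ • X` under `ν` is integrating `ρ • X` under `μ`. Since
  -- `ρ` is `m`-measurable, `X` may there be replaced by `μ[X | m]`.
  have h1 : ν[fun x => Λ x • (μ[X | m]) x | m] =ᵐ[ν] ν[fun x => Λ x • X x | m] := by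
    refine ae_eq_condExp_of_forall_setIntegral_eq hm (int_Λ X hX)
      (fun s _ _ => integrable_condExp.integrableOn) (fun s hs _ => ?_)
      stronglyMeasurable_condExp.aestronglyMeasurable
    rw [setIntegral_condExp hm (int_Λ _ hcond) hs, hν,
      setIntegral_withDensity_ofReal hdm hd0' _ (hm s hs),
      setIntegral_withDensity_ofReal hdm hd0' _ (hm s hs),
      integral_congr_ae (ae_restrict_of_ae (smul_ρ _)),
      integral_congr_ae (ae_restrict_of_ae (smul_ρ _)),
      ← setIntegral_condExp hm (int_ρ X hX) hs]
    refine integral_congr_ae (ae_restrict_of_ae ?_)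
    exact (condExp_smul_of_aestronglyMeasurable_left hρ.aestronglyMeasurable
      (int_ρ X hX) hX).symm
  exact h1.symm.trans (condExp_smul_of_aestronglyMeasurable_right hΛi (int_Λ _ hcond)
    stronglyMeasurable_condExp.aestronglyMeasurable)

/-- Quotients of conditional expectations of bounded convergent approximations converge to the
conditional expectation given by Bayes' formula. -/
theorem tendsto_ae_condExp_quotient_of_withDensity (hm : m ≤ m₀)
    (hd : Integrable d μ) (hd0 : ∀ᵐ x ∂μ, 0 < d x)
    (hρ : StronglyMeasurable[m] ρ) {c : ℝ} (hρc : ∀ x, ‖ρ x‖ ≤ c)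
    (hdΛ : ∀ᵐ x ∂μ, d x * Λ x = ρ x) (hΛ : ∀ᵐ x ∂μ, 0 < Λ x) (hX : Integrable X μ)
    {Λs : ℕ → α → ℝ} {Xs : ℕ → α → E} {B : ℝ}
    (hΛs : ∀ n, AEStronglyMeasurable (Λs n) μ) (hXs : ∀ n, AEStronglyMeasurable (Xs n) μ)
    (hΛs_le : ∀ n, ∀ᵐ x ∂μ, ‖Λs n x‖ ≤ 1) (hXs_le : ∀ n, ∀ᵐ x ∂μ, ‖Xs n x‖ ≤ B)
    (hΛs_lim : ∀ᵐ x ∂μ, Tendsto (fun n => Λs n x) atTop (𝓝 (Λ x)))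
    (hXs_lim : ∀ᵐ x ∂μ, Tendsto (fun n => Xs n x) atTop (𝓝 (X x))) :
    ∀ᵐ x ∂μ, Tendsto (fun n =>
      (((μ.withDensity fun x => ENNReal.ofReal (d x))[Λs n | m]) x)⁻¹ •
        ((μ.withDensity fun x => ENNReal.ofReal (d x))[fun x => Λs n x • Xs n x | m]) x)
      atTop (𝓝 ((μ[X | m]) x)) := by
  have bayes := condExp_smul_eq_smul_condExp_of_withDensity hm hd hd0 hρ hρc hdΛ hX
  have hac : (μ.withDensity fun x => ENNReal.ofReal (d x)) ≪ μ :=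
    withDensity_absolutelyContinuous _ _
  -- Positivity of `d` makes the two measures equivalent, so limits found `ν`-almost everywhere hold
  -- `μ`-almost everywhere.
  have hac' : μ ≪ μ.withDensity fun x => ENNReal.ofReal (d x) :=
    withDensity_absolutelyContinuous' hd.1.aemeasurable.ennreal_ofReal
      (hd0.mono fun x hx => by simpa using hx)
  set ν := μ.withDensity fun x => ENNReal.ofReal (d x) with hν
  have : IsFiniteMeasure ν := isFiniteMeasure_withDensity_ofReal hd.2
  have lim1 : ∀ᵐ x ∂ν, Tendsto (fun n => (ν[Λs n | m]) x) atTop (𝓝 ((ν[Λ | m]) x)) :=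
    tendsto_ae_condExp_of_dominated hm (fun n => (hΛs n).mono_ac hac) (integrable_const (1 : ℝ))
      (fun n => hac.ae_le (hΛs_le n)) (hac.ae_le hΛs_lim)
  have lim2 : ∀ᵐ x ∂ν, Tendsto (fun n => (ν[fun x => Λs n x • Xs n x | m]) x) atTop
      (𝓝 ((ν[fun x => Λ x • X x | m]) x)) := by
    refine tendsto_ae_condExp_of_dominated hm
      (fun n => ((hΛs n).smul (hXs n)).mono_ac hac) (integrable_const (1 * B))
      (fun n => hac.ae_le ?_) (hac.ae_le ?_)
    · filter_upwards [hΛs_le n, hXs_le n] with x h1 h2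
      rw [norm_smul]
      exact mul_le_mul h1 h2 (norm_nonneg _) zero_le_one
    · filter_upwards [hΛs_lim, hXs_lim] with x h1 h2 using h1.smul h2
  have hΛi : Integrable Λ ν := by
    refine (integrable_const (1 : ℝ)).mono'
      ((aestronglyMeasurable_of_tendsto_ae _ hΛs hΛs_lim).mono_ac hac) (hac.ae_le ?_)
    filter_upwards [ae_all_iff.2 hΛs_le, hΛs_lim] with x h1 h2 using le_of_tendsto' h2.norm h1
  have hpos : ∀ᵐ x ∂ν, 0 < (ν[Λ | m]) x := condExp_pos_of_pos hm hΛi (hac.ae_le hΛ)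
  filter_upwards [hac'.ae_le lim1, hac'.ae_le lim2, hac'.ae_le hpos, hac'.ae_le bayes]
    with x h1 h2 h3 h4
  have := (h1.inv₀ h3.ne').smul h2
  rwa [h4, smul_smul, inv_mul_cancel₀ h3.ne', one_smul] at this

end ConditionalExpectation

/-! ### Spectral bounds for quadratic forms and determinants -/

section Matrix

variable {n : Type*} [Fintype n] [DecidableEq n] {A : Matrix n n ℝ} {lam : ℝ}

/-- Subtracting `lam • 1` shifts the spectrum by `lam`, so no eigenvalue becomes negative. -/
theorem posSemidef_sub_smul_one (hA : A.IsHermitian) (h : ∀ e ∈ spectrum ℝ A, lam ≤ e) :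
    (A - lam • (1 : Matrix n n ℝ)).PosSemidef := by
  have hH : (A - lam • (1 : Matrix n n ℝ)).IsHermitian :=
    hA.sub (Matrix.isHermitian_one.smul (IsSelfAdjoint.all lam))
  rw [hH.posSemidef_iff_eigenvalues_nonneg]
  intro i
  have hi := hH.eigenvalues_mem_spectrum_real i
  generalize hH.eigenvalues i = e' at hi ⊢
  rw [← Algebra.algebraMap_eq_smul_one, ← spectrum.sub_singleton_eq] at hi
  obtain ⟨e, he, _, rfl, rfl⟩ := hi
  exact sub_nonneg.2 (h e he)

/-- A lower bound for the eigenvalues of a positive definite matrix gives an upper bound for the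
quadratic form of its inverse. -/
theorem dotProduct_inv_mulVec_le (hA : A.PosDef) (hlam : 0 < lam)
    (h : ∀ e ∈ spectrum ℝ A, lam ≤ e) (v : n → ℝ) :
    v ⬝ᵥ A⁻¹.mulVec v ≤ lam⁻¹ * (v ⬝ᵥ v) := by
  set x := A⁻¹.mulVec v with hx
  have hAx : A.mulVec x = v := by
    rw [hx, Matrix.mulVec_mulVec, Matrix.mul_nonsing_inv _ ((Matrix.isUnit_iff_isUnit_det _).1
      hA.isUnit), Matrix.one_mulVec]
  have h1 := (posSemidef_sub_smul_one hA.isHermitian h).dotProduct_mulVec_nonneg x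
  rw [Matrix.sub_mulVec, hAx, Matrix.smul_mulVec, Matrix.one_mulVec, star_trivial,
    dotProduct_sub, dotProduct_smul, smul_eq_mul, dotProduct_comm x v] at h1
  -- With `x = A⁻¹ v`, `h1` reads `lam |x|² ≤ v·x`. Inserted into the expansion of this square, it
  -- gives `lam (v·x) ≤ |v|²`.
  have h2 : 0 ≤ (v - lam • x) ⬝ᵥ (v - lam • x) := by
    simpa using dotProduct_star_self_nonneg (v - lam • x)
  simp only [sub_dotProduct, dotProduct_sub, smul_dotProduct, dotProduct_smul, smul_eq_mul,
    dotProduct_comm x v] at h2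
  rw [inv_mul_eq_div, le_div_iff₀ hlam]
  nlinarith

theorem one_le_det_of_spectrum (hA : A.IsHermitian) (h : ∀ e ∈ spectrum ℝ A, 1 ≤ e) :
    1 ≤ A.det := by
  rw [hA.det_eq_prod_eigenvalues]
  calc (1 : ℝ) = ∏ _i : n, (1 : ℝ) := by simp
    _ ≤ _ := Finset.prod_le_prod (fun _ _ => zero_le_one)
      fun i _ => h _ (hA.eigenvalues_mem_spectrum_real i)

theorem det_le_pow_of_spectrum (hA : A.PosDef) (h : ∀ e ∈ spectrum ℝ A, e ≤ lam) :
    A.det ≤ lam ^ Fintype.card n := by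
  rw [hA.isHermitian.det_eq_prod_eigenvalues, ← Finset.card_univ, ← Finset.prod_const]
  exact Finset.prod_le_prod (fun i _ => (hA.eigenvalues_pos i).le)
    fun i _ => h _ (hA.isHermitian.eigenvalues_mem_spectrum_real i)

end Matrix

/-! ### Bounds and continuity of Gaussian densities -/

section GaussianDensity

variable {N : ℕ} {m y : Vec N} {C : Matrix (Fin N) (Fin N) ℝ} {lam : ℝ}

theorem gaussianDensity_pos (hC : C.PosDef) : 0 < gaussianDensity m C y := by
  have := hC.det_pos
  unfold gaussianDensity
  positivity

theorem ofLp_dotProduct_self (v : Vec N) : v.ofLp ⬝ᵥ v.ofLp = ‖v‖ ^ 2 := by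
  rw [EuclideanSpace.real_norm_sq_eq]
  simp [dotProduct, sq]

theorem gaussianDensity_zero_one (y : Vec N) :
    gaussianDensity 0 1 y = (√(2 * Real.pi) ^ N)⁻¹ * Real.exp (-(1 / 2) * ‖y‖ ^ 2) := by
  simp [gaussianDensity, ofLp_dotProduct_self]

theorem scaled_gaussianDensity_le_one (hC : C.PosDef) (hdet : 1 ≤ C.det) :
    √(2 * Real.pi) ^ N * gaussianDensity m C y ≤ 1 := by
  have h2 : 0 < √(2 * Real.pi) ^ N := by positivity
  have h3 := hC.inv.posSemidef.dotProduct_mulVec_nonneg (y - m).ofLp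
  rw [star_trivial] at h3
  rw [gaussianDensity, ← mul_assoc, ← mul_assoc, mul_inv_cancel₀ h2.ne', one_mul]
  refine mul_le_one₀ (inv_le_one_of_one_le₀ (Real.one_le_sqrt.2 hdet)) (Real.exp_pos _).le ?_
  rw [Real.exp_le_one_iff]
  linarith

/-- When the eigenvalues of `C` exceed those of the identity, the standard Gaussian density is
dominated by a multiple of the density of `𝒩(m, C)`. -/
theorem gaussianDensity_ratio_le (hC : C.PosDef) (hlam : 1 < lam)
    (h : ∀ e ∈ spectrum ℝ C, lam ≤ e) :
    gaussianDensity 0 1 y / gaussianDensity m C y ≤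
      √C.det * Real.exp (1 / 2 * (‖m‖ ^ 2 / (lam - 1))) := by
  rw [div_le_iff₀ (gaussianDensity_pos hC), gaussianDensity_zero_one, gaussianDensity]
  have hdet := hC.det_pos
  have hq := dotProduct_inv_mulVec_le hC (by linarith) h (y - m).ofLp
  rw [ofLp_dotProduct_self] at hq
  set q := (y - m).ofLp ⬝ᵥ C⁻¹.mulVec (y - m).ofLp
  have hlam' : 0 < lam - 1 := by linarith
  -- Completing the square: the slack `lam - 1 > 0` absorbs the cross term `2‖y‖‖m‖`, leaving a
  -- constant free of `y`.
  have hnorm : lam⁻¹ * ‖y - m‖ ^ 2 ≤ ‖m‖ ^ 2 / (lam - 1) + ‖y‖ ^ 2 := by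
    have h1 : ‖y - m‖ ^ 2 ≤ (‖y‖ + ‖m‖) ^ 2 := by gcongr; exact norm_sub_le _ _
    rw [inv_mul_le_iff₀ (by linarith), ← sub_nonneg]
    have h2 : lam * (‖m‖ ^ 2 / (lam - 1) + ‖y‖ ^ 2) - (‖y‖ + ‖m‖) ^ 2 =
        ((lam - 1) * ‖y‖ - ‖m‖) ^ 2 / (lam - 1) := by
      field_simp
      ring
    have h3 : 0 ≤ ((lam - 1) * ‖y‖ - ‖m‖) ^ 2 / (lam - 1) := by positivity
    linarith
  have hexp : Real.exp (-(1 / 2) * ‖y‖ ^ 2) ≤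
      Real.exp (1 / 2 * (‖m‖ ^ 2 / (lam - 1))) * Real.exp (-(1 / 2) * q) := by
    rw [← Real.exp_add, Real.exp_le_exp]
    linarith
  calc (√(2 * Real.pi) ^ N)⁻¹ * Real.exp (-(1 / 2) * ‖y‖ ^ 2)
      ≤ (√(2 * Real.pi) ^ N)⁻¹ *
        (Real.exp (1 / 2 * (‖m‖ ^ 2 / (lam - 1))) * Real.exp (-(1 / 2) * q)) := by gcongr
    _ = _ := by
      have : √C.det ≠ 0 := by positivity
      field_simp

theorem continuousOn_gaussianDensity {α : Type*} [TopologicalSpace α] {s : Set α}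
    {m y : α → Vec N} {C : α → Matrix (Fin N) (Fin N) ℝ} (hm : ContinuousOn m s)
    (hC : ContinuousOn C s) (hy : ContinuousOn y s) (hpos : ∀ x ∈ s, (C x).PosDef) :
    ContinuousOn (fun x => gaussianDensity (m x) (C x) (y x)) s := by
  have hdet : ContinuousOn (fun x => (C x).det) s :=
    continuous_id.matrix_det.comp_continuousOn hC
  have hsqrt : ContinuousOn (fun x => (√(C x).det)⁻¹) s :=
    hdet.sqrt.inv₀ fun x hx => (Real.sqrt_pos.2 (hpos x hx).det_pos).ne'
  -- The inverse is the adjugate divided by the determinant, which does not vanish on `s`.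
  have hinv : ContinuousOn (fun x => (C x)⁻¹) s := by
    simp only [Matrix.inv_def, Ring.inverse_eq_inv']
    exact (hdet.inv₀ fun x hx => (hpos x hx).det_pos.ne').smul
      (continuous_id.matrix_adjugate.comp_continuousOn hC)
  have hv : ContinuousOn (fun x => (y x - m x).ofLp) s :=
    (PiLp.continuous_ofLp 2 _).comp_continuousOn (hy.sub hm)
  have hq : Continuous fun p : (Fin N → ℝ) × Matrix (Fin N) (Fin N) ℝ =>
      p.1 ⬝ᵥ p.2.mulVec p.1 :=
    continuous_fst.dotProduct (continuous_snd.matrix_mulVec continuous_fst)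
  exact (continuousOn_const.mul hsqrt).mul
    (continuousOn_const.mul (hq.comp_continuousOn (hv.prodMk hinv))).rexp

end GaussianDensity

section L1Norm

variable {n : ℕ}

/-! ### The `ℓ₁`-norm -/

theorem l1Norm_nonneg (x : Vec n) : 0 ≤ l1Norm x := Finset.sum_nonneg fun _ _ => abs_nonneg _

theorem continuous_l1Norm : Continuous (l1Norm : Vec n → ℝ) := by
  unfold l1Norm
  fun_prop

theorem l1Norm_zero : l1Norm (0 : Vec n) = 0 := by simp [l1Norm]

theorem abs_apply_le_l1Norm (x : Vec n) (i : Fin n) : |x i| ≤ l1Norm x :=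
  Finset.single_le_sum (f := fun i => |x i|) (fun _ _ => abs_nonneg _) (Finset.mem_univ i)

theorem l1Norm_sub_le (x y z : Vec n) : l1Norm (x - z) ≤ l1Norm (x - y) + l1Norm (y - z) := by
  rw [l1Norm, l1Norm, l1Norm, ← Finset.sum_add_distrib]
  exact Finset.sum_le_sum fun i _ => abs_sub_le (x i) (y i) (z i)

theorem tendsto_of_tendsto_l1Norm {ι : Type*} {l : Filter ι} {f : ι → Vec n} {x : Vec n}
    (h : Tendsto (fun i => l1Norm (f i - x)) l (𝓝 0)) : Tendsto f l (𝓝 x) := by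
  have h1 : Tendsto (fun i => (f i).ofLp) l (𝓝 x.ofLp) := by
    rw [tendsto_pi_nhds]
    intro k
    rw [tendsto_iff_dist_tendsto_zero]
    exact squeeze_zero (fun _ => dist_nonneg) (fun i => abs_apply_le_l1Norm (f i - x) k) h
  exact ((PiLp.continuous_toLp 2 _).tendsto _).comp h1

theorem tendsto_l1Norm_sub (x : Vec n) (l : Filter (Vec n)) (hl : l ≤ 𝓝 x) (K : ℝ) :
    Tendsto (fun z => K * l1Norm (z - x)) l (𝓝 0) := by
  have : Continuous fun z : Vec n => K * l1Norm (z - x) :=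
    continuous_const.mul (continuous_l1Norm.comp (continuous_id.sub continuous_const))
  simpa [l1Norm_zero] using (this.tendsto x).mono_left hl

end L1Norm

/-! ### Consequences of the regularity of the observation model -/

section ObservationModel

variable {M N : ℕ} {O : ObservationModel M N} {Z : Set (Vec M)}

theorem ObservationModel.IsRegular.posDef_cov (hO : O.IsRegular Z) (t : ℕ) {x : Vec M}
    (hx : x ∈ Z) : (O.cov t x).PosDef :=
  (hO.posDef t x hx).add_posSemidef (Matrix.PosSemidef.one.smul (sq_nonneg O.sigma))

theorem ObservationModel.IsRegular.one_le_det_cov (hO : O.IsRegular Z) (t : ℕ) {x : Vec M}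
    (hx : x ∈ Z) : 1 ≤ (O.cov t x).det := by
  obtain ⟨lam, hlam, h⟩ := hO.one_lt_eigenvalue
  exact one_le_det_of_spectrum (hO.posDef_cov t hx).isHermitian
    fun e he => hlam.le.trans (h t x hx e he)

theorem ObservationModel.IsRegular.continuousOn_mean (hO : O.IsRegular Z) (t : ℕ) :
    ContinuousOn (O.mean t) Z := by
  obtain ⟨K, hK⟩ := hO.mean_lipschitz
  intro x hx
  refine tendsto_of_tendsto_l1Norm (squeeze_zero' (Eventually.of_forall fun _ => l1Norm_nonneg _)
    ?_ (tendsto_l1Norm_sub x (𝓝[Z] x) nhdsWithin_le_nhds K))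
  filter_upwards [self_mem_nhdsWithin] with z hz using hK t z hz x hx

theorem ObservationModel.IsRegular.continuousOn_cov (hO : O.IsRegular Z) (t : ℕ) :
    ContinuousOn (O.cov t) Z := by
  obtain ⟨K, hK⟩ := hO.Sig_lipschitz
  refine ContinuousOn.add ?_ continuousOn_const
  intro x hx
  refine tendsto_pi_nhds.2 fun i => tendsto_pi_nhds.2 fun j => ?_
  rw [tendsto_iff_dist_tendsto_zero]
  refine squeeze_zero' (Eventually.of_forall fun _ => dist_nonneg) ?_
    (tendsto_l1Norm_sub x (𝓝[Z] x) nhdsWithin_le_nhds K)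
  filter_upwards [self_mem_nhdsWithin] with z hz using hK t z hz x hx i j

theorem ObservationModel.IsRegular.continuousOn_gaussianDensity (hO : O.IsRegular Z) (t : ℕ) :
    ContinuousOn (fun p : Vec M × Vec N => gaussianDensity (O.mean t p.1) (O.cov t p.1) p.2)
      (Z ×ˢ Set.univ) :=
  GridFilter.continuousOn_gaussianDensity
    ((hO.continuousOn_mean t).comp continuousOn_fst fun _ hp => hp.1)
    ((hO.continuousOn_cov t).comp continuousOn_fst fun _ hp => hp.1)
    continuousOn_snd fun _ hp => hO.posDef_cov t hp.1

theorem ObservationModel.IsRegular.likelihood_pos (hO : O.IsRegular Z) (t : ℕ) {x : Vec M}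
    (hx : x ∈ Z) (y : Vec N) : 0 < likelihood O t x y :=
  mul_pos (by positivity) (gaussianDensity_pos (hO.posDef_cov t hx))

theorem ObservationModel.IsRegular.likelihood_le_one (hO : O.IsRegular Z) (t : ℕ) {x : Vec M}
    (hx : x ∈ Z) (y : Vec N) : likelihood O t x y ≤ 1 :=
  scaled_gaussianDensity_le_one (hO.posDef_cov t hx) (hO.one_le_det_cov t hx)

/-- The likelihood ratio of the change of measure is bounded, uniformly in time and state. -/
theorem ObservationModel.IsRegular.exists_ratio_le (hO : O.IsRegular Z) :
    ∃ B : ℝ, 0 ≤ B ∧ ∀ t, ∀ x ∈ Z, ∀ y : Vec N,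
      gaussianDensity 0 1 y / gaussianDensity (O.mean t x) (O.cov t x) y ≤ B := by
  obtain ⟨lam, hlam, hinf⟩ := hO.one_lt_eigenvalue
  obtain ⟨lamSup, hsup⟩ := hO.eigenvalue_le
  obtain ⟨mu, hmu⟩ := hO.mean_bounded
  refine ⟨√(lamSup ^ N) * Real.exp (1 / 2 * (mu ^ 2 / (lam - 1))), by positivity,
    fun t x hx y => ?_⟩
  have hC := hO.posDef_cov t hx
  refine (gaussianDensity_ratio_le hC hlam (hinf t x hx)).trans ?_
  have h1 := det_le_pow_of_spectrum hC (hsup t x hx)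
  rw [Fintype.card_fin] at h1
  have h2 := hmu t x hx
  have h3 : 0 < lam - 1 := by linarith
  gcongr

end ObservationModel

/-! ### The uniform quantizer and its error -/

section Quantizer

variable {M : ℕ} {a b : ℝ} {L : ℕ} {cell : Fin L → Set ℝ}

theorem isClosed_stateCube (M : ℕ) (a b : ℝ) : IsClosed (stateCube M a b) := by
  have : stateCube M a b = ⋂ m, {x : Vec M | x m ∈ Set.Icc a b} := by
    ext x
    simp [stateCube]
  rw [this]
  exact isClosed_iInter fun m => isClosed_Icc.preimage (by fun_prop)

theorem l1Norm_le_of_mem_stateCube {x : Vec M} (hx : x ∈ stateCube M a b) :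
    l1Norm x ≤ M * max |a| |b| := by
  calc l1Norm x ≤ ∑ _i : Fin M, max |a| |b| :=
        Finset.sum_le_sum fun i _ => abs_le_max_abs_abs (hx i).1 (hx i).2
    _ = _ := by simp

theorem norm_le_l1Norm (x : Vec M) : ‖x‖ ≤ l1Norm x := by
  rw [EuclideanSpace.norm_eq, l1Norm]
  refine Real.sqrt_le_iff.2 ⟨Finset.sum_nonneg fun _ _ => abs_nonneg _, ?_⟩
  exact Finset.sum_sq_le_sq_sum_of_nonneg fun _ _ => abs_nonneg _

/-- A cell is an open interval together with some of its two endpoints. -/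
theorem IsUniformPartition.measurableSet (hc : IsUniformPartition a b L cell) (l : Fin L) :
    MeasurableSet (cell l) := by
  set u := a + (l : ℝ) * (b - a) / L
  set v := a + ((l : ℝ) + 1) * (b - a) / L
  have h : cell l = Set.Ioo u v ∪ (cell l ∩ {u, v}) := by
    apply Set.Subset.antisymm
    · intro x hx
      by_cases h : x = u ∨ x = v
      · exact Or.inr ⟨hx, h⟩
      · rw [not_or] at h
        have := hc.subset_closure l hx
        exact Or.inl ⟨lt_of_le_of_ne this.1 (Ne.symm h.1), lt_of_le_of_ne this.2 h.2⟩
    · exact Set.union_subset (hc.interior_subset l) Set.inter_subset_left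
  rw [h]
  exact measurableSet_Ioo.union
    (((Set.finite_singleton v).insert u).subset Set.inter_subset_right).measurableSet

theorem measurable_quantizer (hc : IsUniformPartition a b L cell) :
    Measurable (quantizer a b cell : Vec M → Vec M) := by
  refine (PiLp.continuous_toLp 2 _).measurable.comp (measurable_pi_lambda _ fun m => ?_)
  refine Finset.measurable_sum _ fun l _ => ?_
  exact (measurable_const.indicator (hc.measurableSet l)).comp
    (PiLp.continuous_apply 2 _ m).measurable

/-- The grid point with multi-index `k`. -/
noncomputable def gridPoint (M : ℕ) (a b : ℝ) (L : ℕ) (k : Fin M → Fin L) : Vec M :=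
  WithLp.toLp 2 fun m => cellCenter a b L (k m)

theorem cellCenter_mem_Icc (hab : a ≤ b) (l : Fin L) : cellCenter a b L l ∈ Set.Icc a b := by
  have hL : (0 : ℝ) < L := by exact_mod_cast l.pos
  have hl : (l : ℝ) + 1 ≤ L := by exact_mod_cast l.2
  have hba : 0 ≤ b - a := sub_nonneg.2 hab
  constructor
  · unfold cellCenter
    have : 0 ≤ ((l : ℝ) + 1 / 2) * (b - a) / L := by positivity
    linarith
  · have : ((l : ℝ) + 1 / 2) * (b - a) / L ≤ b - a := by
      rw [div_le_iff₀ hL]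
      nlinarith
    unfold cellCenter
    linarith

theorem gridPoint_mem_stateCube (hab : a ≤ b) (k : Fin M → Fin L) :
    gridPoint M a b L k ∈ stateCube M a b := fun m => cellCenter_mem_Icc hab (k m)

theorem quantizer_apply_of_mem (hc : IsUniformPartition a b L cell) {x : Vec M} {m : Fin M}
    {l : Fin L} (hl : x m ∈ cell l) : quantizer a b cell x m = cellCenter a b L l := by
  change ∑ l', (cell l').indicator (fun _ => cellCenter a b L l') (x m) = _
  rw [Finset.sum_eq_single l]
  · exact Set.indicator_of_mem hl _
  · intro l' _ hne
    exact Set.indicator_of_notMem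
      (fun h => Set.disjoint_left.1 (hc.pairwise_disjoint hne) h hl) _
  · simp

theorem exists_index_of_mem_stateCube (hc : IsUniformPartition a b L cell) {x : Vec M}
    (hx : x ∈ stateCube M a b) : ∃ k : Fin M → Fin L, ∀ m, x m ∈ cell (k m) := by
  have : ∀ m, ∃ l, x m ∈ cell l := fun m => by
    have := hx m
    rwa [← hc.cover, Set.mem_iUnion] at this
  exact Classical.axiom_of_choice this

theorem exists_quantizer_eq_gridPoint (hc : IsUniformPartition a b L cell) {x : Vec M}
    (hx : x ∈ stateCube M a b) : ∃ k, quantizer a b cell x = gridPoint M a b L k := by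
  obtain ⟨k, hk⟩ := exists_index_of_mem_stateCube hc hx
  exact ⟨k, by ext m; exact quantizer_apply_of_mem hc (hk m)⟩

theorem quantizer_mem_stateCube (hab : a ≤ b) (hc : IsUniformPartition a b L cell) {x : Vec M}
    (hx : x ∈ stateCube M a b) : quantizer a b cell x ∈ stateCube M a b := by
  obtain ⟨k, hk⟩ := exists_quantizer_eq_gridPoint hc hx
  rw [hk]
  exact gridPoint_mem_stateCube hab k

/-- The quantization error. -/
theorem l1Norm_quantizer_sub_le (hc : IsUniformPartition a b L cell) {x : Vec M}
    (hx : x ∈ stateCube M a b) : l1Norm (quantizer a b cell x - x) ≤ M * ((b - a) / (2 * L)) := by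
  obtain ⟨k, hk⟩ := exists_index_of_mem_stateCube hc hx
  calc l1Norm (quantizer a b cell x - x) ≤ ∑ _m : Fin M, (b - a) / (2 * L) := by
        refine Finset.sum_le_sum fun m _ => ?_
        have h1 := hc.subset_closure (k m) (hk m)
        rw [PiLp.sub_apply, quantizer_apply_of_mem hc (hk m), cellCenter, abs_le]
        have hL : (L : ℝ) ≠ 0 := by exact_mod_cast (k m).pos.ne'
        -- The centre is half a cell width, `(b - a) / (2 * L)`, from either end of its cell.
        have e1 : a + ((k m : ℝ) + 1 / 2) * (b - a) / L =
            a + (k m : ℝ) * (b - a) / L + (b - a) / (2 * L) := by field_simp; ring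
        have e2 : a + ((k m : ℝ) + 1 / 2) * (b - a) / L =
            a + ((k m : ℝ) + 1) * (b - a) / L - (b - a) / (2 * L) := by field_simp; ring
        constructor
        · linarith [h1.2]
        · linarith [h1.1]
    _ = _ := by simp

theorem tendsto_quantization_error_bound (M : ℕ) (a b : ℝ) :
    Tendsto (fun L : ℕ => (M : ℝ) * ((b - a) / (2 * (L : ℝ)))) atTop (𝓝 0) := by
  have h : Tendsto (fun L : ℕ => 2 * (L : ℝ)) atTop atTop :=
    tendsto_natCast_atTop_atTop.const_mul_atTop two_pos
  simpa using (h.const_div_atTop (b - a)).const_mul (M : ℝ)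

end Quantizer

/-! ### Almost sure convergence of the quantized states -/

section Quantization

/-- Merges the two clauses of the recursion, so that inductions can start at time `-1`, which is
index 0 of `prevState`. -/
theorem markovianQuantization_eq {Ω : Type*} {M MW : ℕ} {f : ℕ → Vec M → Vec MW → Vec M}
    {Xinit : Ω → Vec M} {W : ℕ → Ω → Vec MW} (q : Vec M → Vec M) (t : ℕ) (ω : Ω) :
    markovianQuantization q f Xinit W t ω =
      q (f t (prevState (fun ω => q (Xinit ω)) (markovianQuantization q f Xinit W) t ω)
        (W t ω)) := by
  cases t <;> rfl

variable {Ω : Type*} [MeasurableSpace Ω] {P : Measure Ω} {M : ℕ} {a b : ℝ}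
  {cell : (L : ℕ) → Fin L → Set ℝ}

/-- The approximations `XL` are measurable, stay almost surely in `Z` and converge almost surely
to the state `X`. -/
structure IsApproximation (P : Measure Ω) (Z : Set (Vec M)) (X : ℕ → Ω → Vec M)
    (XL : ℕ → ℕ → Ω → Vec M) : Prop where
  measurable : ∀ L t, Measurable (XL L t)
  mem : ∀ L t, ∀ᵐ ω ∂P, XL L t ω ∈ Z
  tendsto : ∀ t, ∀ᵐ ω ∂P, Tendsto (fun L => XL L t ω) atTop (𝓝 (X t ω))

/-- The error bound is pathwise and of order `1/L`. The index is shifted to `L + 1` because `hcell`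
says nothing about `L = 0`. -/
theorem isApproximation_marginalQuantization (hab : a ≤ b) {X : ℕ → Ω → Vec M}
    (hX : ∀ t, Measurable (X t)) (hXZ : ∀ t, ∀ᵐ ω ∂P, X t ω ∈ stateCube M a b)
    (hcell : ∀ L, 1 ≤ L → IsUniformPartition a b L (cell L)) :
    IsApproximation P (stateCube M a b) X
      (fun L => marginalQuantization (quantizer a b (cell (L + 1))) X) where
  measurable L t := (measurable_quantizer (hcell (L + 1) (by omega))).comp (hX t)
  mem L t := (hXZ t).mono fun ω hω =>
    quantizer_mem_stateCube hab (hcell (L + 1) (by omega)) hω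
  tendsto t := by
    filter_upwards [hXZ t] with ω hω
    refine tendsto_of_tendsto_l1Norm (squeeze_zero (fun _ => l1Norm_nonneg _)
      (fun L => l1Norm_quantizer_sub_le (hcell (L + 1) (by omega)) hω) ?_)
    exact (tendsto_add_atTop_iff_nat 1).2 (tendsto_quantization_error_bound M a b)

variable {MW N : ℕ} {𝒲 : Set (Vec MW)} {O : ObservationModel M N}
  {f : ℕ → Vec M → Vec MW → Vec M} {Xinit : Ω → Vec M} {W : ℕ → Ω → Vec MW}
  {X : ℕ → Ω → Vec M} {y : ℕ → Ω → Vec N}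

theorem measurable_markovianQuantization {q : Vec M → Vec M} (hq : Measurable q)
    (hf : ∀ t, Measurable fun p : Vec M × Vec MW => f t p.1 p.2) (hXinit : Measurable Xinit)
    (hW : ∀ t, Measurable (W t)) (t : ℕ) : Measurable (markovianQuantization q f Xinit W t) := by
  induction t with
  | zero => exact hq.comp ((hf 0).comp ((hq.comp hXinit).prodMk (hW 0)))
  | succ t ih => exact hq.comp ((hf (t + 1)).comp (ih.prodMk (hW (t + 1))))

/-- Since the quantized state has finitely many values, almost surely no transition from a
quantized state leaves the state domain. -/
theorem IsStateSpaceModel.ae_transition_gridPoint_mem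
    (h : IsStateSpaceModel P (stateCube M a b) 𝒲 O f Xinit W X y) (hab : a ≤ b) :
    ∀ᵐ ω ∂P, ∀ (L t : ℕ) (k : Fin M → Fin L),
      f t (gridPoint M a b L k) (W t ω) ∈ stateCube M a b :=
  ae_all_iff.2 fun _ => ae_all_iff.2 fun t => ae_all_iff.2 fun k =>
    h.transition_mem t _ (gridPoint_mem_stateCube hab k)

/-- One null set is discarded before the induction; off it, every transition from a grid point stays
in the cube and is quantized to a grid point again. -/
theorem IsStateSpaceModel.ae_markovianQuantization_eq_gridPoint
    (h : IsStateSpaceModel P (stateCube M a b) 𝒲 O f Xinit W X y) (hab : a ≤ b)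
    (hcell : ∀ L, 1 ≤ L → IsUniformPartition a b L (cell L)) :
    ∀ᵐ ω ∂P, ∀ L, 1 ≤ L → ∀ t, ∃ k, prevState (fun ω => quantizer a b (cell L) (Xinit ω))
      (markovianQuantization (quantizer a b (cell L)) f Xinit W) t ω = gridPoint M a b L k := by
  filter_upwards [h.init_mem, h.ae_transition_gridPoint_mem hab] with ω hinit htrans L hL t
  induction t with
  | zero => exact exists_quantizer_eq_gridPoint (hcell L hL) hinit
  | succ t ih =>
    obtain ⟨k, hk⟩ := ih
    change ∃ k, markovianQuantization (quantizer a b (cell L)) f Xinit W t ω = _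
    rw [markovianQuantization_eq, hk]
    exact exists_quantizer_eq_gridPoint (hcell L hL) (htrans L t k)

theorem IsStateSpaceModel.isApproximation_markovianQuantization
    (h : IsStateSpaceModel P (stateCube M a b) 𝒲 O f Xinit W X y)
    (hf : IsLipschitzTransition (stateCube M a b) 𝒲 f) (hab : a ≤ b)
    (hcell : ∀ L, 1 ≤ L → IsUniformPartition a b L (cell L)) :
    IsApproximation P (stateCube M a b) X
      (fun L => markovianQuantization (quantizer a b (cell (L + 1))) f Xinit W) where
  measurable L := measurable_markovianQuantization (measurable_quantizer (hcell (L + 1) (by omega)))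
    h.measurable_transition h.measurable_init h.measurable_noise
  mem L t := by
    filter_upwards [h.ae_markovianQuantization_eq_gridPoint hab hcell] with ω hω
    obtain ⟨k, hk⟩ := hω (L + 1) (by omega) (t + 1)
    change markovianQuantization (quantizer a b (cell (L + 1))) f Xinit W t ω = _ at hk
    rw [hk]
    exact gridPoint_mem_stateCube hab k
  tendsto t := by
    obtain ⟨K, hK⟩ := hf
    filter_upwards [h.ae_markovianQuantization_eq_gridPoint hab hcell, h.init_mem,
      h.ae_transition_gridPoint_mem hab, ae_all_iff.2 h.state_mem, ae_all_iff.2 h.recursion,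
      ae_all_iff.2 h.noise_mem] with ω hgrid hinit htrans hmem hrec hnoise
    have hbound := (tendsto_add_atTop_iff_nat 1).2 (tendsto_quantization_error_bound M a b)
    have hprev : ∀ t, prevState Xinit X t ω ∈ stateCube M a b := fun t => by
      cases t with
      | zero => exact hinit
      | succ t => exact hmem t
    -- Pathwise, the next error is at most a fresh quantization error plus `K t (W t ω)` times the
    -- current one, and this factor does not depend on `L`.
    have key : ∀ t, Tendsto (fun L : ℕ => l1Norm (prevState
        (fun ω => quantizer a b (cell (L + 1)) (Xinit ω))
        (markovianQuantization (quantizer a b (cell (L + 1))) f Xinit W) t ω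
          - prevState Xinit X t ω)) atTop (𝓝 0) := by
      intro t
      induction t with
      | zero =>
        exact squeeze_zero (fun _ => l1Norm_nonneg _)
          (fun L => l1Norm_quantizer_sub_le (hcell (L + 1) (by omega)) hinit) hbound
      | succ t ih =>
        have hlim := hbound.add (ih.const_mul (K t (W t ω)))
        rw [mul_zero, add_zero] at hlim
        refine squeeze_zero (fun _ => l1Norm_nonneg _) (fun L => ?_) hlim
        change l1Norm (markovianQuantization _ f Xinit W t ω - X t ω) ≤ _
        obtain ⟨k, hk⟩ := hgrid (L + 1) (by omega) t
        rw [markovianQuantization_eq, hrec t, hk]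
        -- The intermediate point is the unquantized image of the quantized state.
        refine (l1Norm_sub_le _ (f t (gridPoint M a b (L + 1) k) (W t ω)) _).trans (add_le_add ?_ ?_)
        · exact l1Norm_quantizer_sub_le (hcell (L + 1) (by omega)) (htrans (L + 1) t k)
        · exact ((hK t).2 _ (hnoise t)).2 _ (gridPoint_mem_stateCube hab k) _ (hprev t)
    exact tendsto_of_tendsto_l1Norm (key (t + 1))

end Quantization

/-! ### Bounds and convergence of the likelihood process -/

section LikelihoodProcess

variable {Ω : Type*} {M N : ℕ} {O : ObservationModel M N} {Z : Set (Vec M)}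
  {X : ℕ → Ω → Vec M} {y : ℕ → Ω → Vec N}

theorem ObservationModel.IsRegular.likelihoodProcess_pos (hO : O.IsRegular Z) {t : ℕ} {ω : Ω}
    (h : ∀ i, X i ω ∈ Z) : 0 < likelihoodProcess O X y t ω :=
  Finset.prod_pos fun i _ => hO.likelihood_pos i (h i) _

theorem ObservationModel.IsRegular.likelihoodProcess_le_one (hO : O.IsRegular Z) {t : ℕ} {ω : Ω}
    (h : ∀ i, X i ω ∈ Z) : likelihoodProcess O X y t ω ≤ 1 :=
  Finset.prod_le_one (fun i _ => (hO.likelihood_pos i (h i) _).le)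
    fun i _ => hO.likelihood_le_one i (h i) _

theorem ObservationModel.IsRegular.tendsto_likelihoodProcess (hO : O.IsRegular Z)
    {XL : ℕ → ℕ → Ω → Vec M} {t : ℕ} {ω : Ω} (h : ∀ i, X i ω ∈ Z) (hL : ∀ L i, XL L i ω ∈ Z)
    (hlim : ∀ i, Tendsto (fun L => XL L i ω) atTop (𝓝 (X i ω))) :
    Tendsto (fun L => likelihoodProcess O (XL L) y t ω) atTop
      (𝓝 (likelihoodProcess O X y t ω)) := by
  refine tendsto_finsetProd _ fun i _ => ?_
  refine Tendsto.const_mul _ ?_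
  have hc := hO.continuousOn_gaussianDensity (N := N) i (X i ω, y i ω) ⟨h i, trivial⟩
  refine hc.tendsto.comp (f := fun L => (XL L i ω, y i ω)) ?_
  exact tendsto_nhdsWithin_iff.2 ⟨(hlim i).prodMk_nhds tendsto_const_nhds,
    Eventually.of_forall fun L => ⟨hL L i, trivial⟩⟩

end LikelihoodProcess

/-! ### Convergence of the approximate filters -/

section Filters

variable {Ω : Type*} [MeasurableSpace Ω] {P : Measure Ω} {M N : ℕ} {a b : ℝ}
  {O : ObservationModel M N} {Z : Set (Vec M)} {X : ℕ → Ω → Vec M} {y : ℕ → Ω → Vec N}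

theorem observationSigma_le (hy : ∀ t, Measurable (y t)) (t : ℕ) :
    observationSigma P y t ≤ ‹MeasurableSpace Ω› :=
  sup_le (iSup₂_le fun i _ => (hy i).comap_le)
    (MeasurableSpace.generateFrom_le fun _ hs => hs.1)

theorem measurable_observation {i t : ℕ} (hi : i ≤ t) :
    Measurable[observationSigma P y t] (y i) := by
  refine Measurable.mono (comap_measurable (y i)) ?_ le_rfl
  exact le_sup_of_le_left (le_iSup₂_of_le i hi le_rfl)

/-- The density is controlled only on `Z`, where it is continuous; this suffices because the law of
`(x, z)` is concentrated on the closed set `Z ×ˢ univ`. -/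
theorem ObservationModel.IsRegular.aemeasurable_gaussianDensity (hO : O.IsRegular Z)
    (hZ : IsClosed Z) (i : ℕ) {x : Ω → Vec M} {z : Ω → Vec N} (hx : Measurable x)
    (hz : Measurable z) (hxZ : ∀ᵐ ω ∂P, x ω ∈ Z) :
    AEMeasurable (fun ω => gaussianDensity (O.mean i (x ω)) (O.cov i (x ω)) (z ω)) P := by
  have hS : MeasurableSet (Z ×ˢ (Set.univ : Set (Vec N))) :=
    hZ.measurableSet.prod MeasurableSet.univ
  have h := (hO.continuousOn_gaussianDensity (N := N) i).aemeasurable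
    (μ := P.map fun ω => (x ω, z ω)) hS
  rw [Measure.restrict_eq_self_of_ae_mem] at h
  · exact h.comp_measurable (hx.prodMk hz)
  · refine (ae_map_iff (p := fun p => p ∈ Z ×ˢ Set.univ) (hx.prodMk hz).aemeasurable hS).2 ?_
    filter_upwards [hxZ] with ω hω using ⟨hω, trivial⟩

theorem ObservationModel.IsRegular.aemeasurable_likelihoodProcess (hO : O.IsRegular Z)
    (hZ : IsClosed Z) (hX : ∀ t, Measurable (X t)) (hy : ∀ t, Measurable (y t))
    (hXZ : ∀ t, ∀ᵐ ω ∂P, X t ω ∈ Z) (t : ℕ) : AEMeasurable (likelihoodProcess O X y t) P :=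
  Finset.aemeasurable_fun_prod _ fun i _ =>
    (hO.aemeasurable_gaussianDensity hZ i (hX i) (hy i) (hXZ i)).const_mul _

/-- Almost sure convergence of the approximate filters. -/
theorem IsApproximation.ae_tendsto_approxFilter [IsFiniteMeasure P]
    {XL : ℕ → ℕ → Ω → Vec M} (hXL : IsApproximation P (stateCube M a b) X XL)
    (hO : O.IsRegular (stateCube M a b)) (hX : ∀ t, Measurable (X t))
    (hXZ : ∀ t, ∀ᵐ ω ∂P, X t ω ∈ stateCube M a b) (hy : ∀ t, Measurable (y t)) (t : ℕ) :
    ∀ᵐ ω ∂P, Tendsto (fun L => approxFilter P O X y (XL L) t ω) atTop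
      (𝓝 (trueFilter P X y t ω)) := by
  have hZ := isClosed_stateCube M a b
  have hXZ' := ae_all_iff.2 hXZ
  have hmem : ∀ L, ∀ᵐ ω ∂P, ∀ i, XL L i ω ∈ stateCube M a b := fun L =>
    ae_all_iff.2 (hXL.mem L)
  have hnorm : ∀ {x : Vec M}, x ∈ stateCube M a b → ‖x‖ ≤ M * max |a| |b| := fun hx =>
    (norm_le_l1Norm _).trans (l1Norm_le_of_mem_stateCube hx)
  have hgauss0 : Continuous (gaussianDensity (0 : Vec N) 1) := by
    simp only [funext gaussianDensity_zero_one]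
    fun_prop
  let d : Ω → ℝ := fun ω => ∏ i ∈ Finset.range (t + 1),
    gaussianDensity 0 1 (y i ω) / gaussianDensity (O.mean i (X i ω)) (O.cov i (X i ω)) (y i ω)
  -- What remains of `d` times the likelihood process: a function of the observations alone.
  let ρ : Ω → ℝ := fun ω => ∏ i ∈ Finset.range (t + 1),
    (√(2 * Real.pi) ^ N * gaussianDensity 0 1 (y i ω))
  have hd0 : ∀ᵐ ω ∂P, 0 < d ω := by
    filter_upwards [hXZ'] with ω hω
    exact Finset.prod_pos fun i _ => div_pos (gaussianDensity_pos Matrix.PosDef.one)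
      (gaussianDensity_pos (hO.posDef_cov i (hω i)))
  have hd : Integrable d P := by
    obtain ⟨B, hB, hle⟩ := hO.exists_ratio_le
    refine Integrable.of_bound (C := B ^ (t + 1))
      (Finset.aemeasurable_fun_prod _ fun i _ => ?_).aestronglyMeasurable ?_
    · exact (hgauss0.measurable.comp (hy i)).aemeasurable.div
        (hO.aemeasurable_gaussianDensity hZ i (hX i) (hy i) (hXZ i))
    · filter_upwards [hXZ', hd0] with ω hω hpos
      rw [Real.norm_of_nonneg hpos.le]
      calc d ω ≤ ∏ _i ∈ Finset.range (t + 1), B :=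
            Finset.prod_le_prod (fun i _ => (div_pos (gaussianDensity_pos Matrix.PosDef.one)
              (gaussianDensity_pos (hO.posDef_cov i (hω i)))).le) fun i _ => hle i _ (hω i) _
        _ = B ^ (t + 1) := by simp
  have hρ : StronglyMeasurable[observationSigma P y t] ρ := by
    refine Finset.stronglyMeasurable_fun_prod (m := observationSigma P y t) _ fun i hi => ?_
    refine Measurable.stronglyMeasurable ?_
    refine (measurable_const.mul hgauss0.measurable).comp (measurable_observation ?_)
    exact Nat.lt_succ_iff.1 (Finset.mem_range.1 hi)
  have hρ1 : ∀ ω, ‖ρ ω‖ ≤ 1 := fun ω => by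
    have hpos : ∀ i, 0 < √(2 * Real.pi) ^ N * gaussianDensity 0 1 (y i ω) := fun i =>
      mul_pos (by positivity) (gaussianDensity_pos Matrix.PosDef.one)
    rw [Real.norm_of_nonneg (Finset.prod_nonneg fun i _ => (hpos i).le)]
    exact Finset.prod_le_one (fun i _ => (hpos i).le) fun i _ =>
      scaled_gaussianDensity_le_one Matrix.PosDef.one Matrix.det_one.ge
  have hdΛ : ∀ᵐ ω ∂P, d ω * likelihoodProcess O X y t ω = ρ ω := by
    filter_upwards [hXZ'] with ω hω
    rw [likelihoodProcess, ← Finset.prod_mul_distrib]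
    refine Finset.prod_congr rfl fun i _ => ?_
    have := (gaussianDensity_pos (m := O.mean i (X i ω)) (y := y i ω)
      (hO.posDef_cov i (hω i))).ne'
    rw [likelihood]
    field_simp
  refine tendsto_ae_condExp_quotient_of_withDensity (observationSigma_le hy t) hd hd0 hρ hρ1 hdΛ
    (hXZ'.mono fun ω hω => hO.likelihoodProcess_pos hω)
    (Integrable.of_bound (hX t).aestronglyMeasurable _ ((hXZ t).mono fun ω hω => hnorm hω))
    (fun L => (hO.aemeasurable_likelihoodProcess hZ (hXL.measurable L) hy
      (hXL.mem L) t).aestronglyMeasurable)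
    (fun L => (hXL.measurable L t).aestronglyMeasurable)
    (fun L => (hmem L).mono fun ω hω => ?_)
    (fun L => (hXL.mem L t).mono fun ω hω => hnorm hω) ?_ (hXL.tendsto t)
  · rw [Real.norm_of_nonneg (hO.likelihoodProcess_pos hω).le]
    exact hO.likelihoodProcess_le_one hω
  · filter_upwards [hXZ', ae_all_iff.2 hmem, ae_all_iff.2 hXL.tendsto] with ω h1 h2 h3
    exact hO.tendsto_likelihoodProcess h1 h2 h3

theorem measurable_approxFilter {XL : ℕ → Ω → Vec M} (hy : ∀ t, Measurable (y t)) (t : ℕ) :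
    Measurable (approxFilter P O X y XL t) := by
  have h1 : Measurable ((refMeasure P O X y t)[likelihoodProcess O XL y t |
      observationSigma P y t]) :=
    (stronglyMeasurable_condExp.mono (observationSigma_le hy t)).measurable
  have h2 : Measurable ((refMeasure P O X y t)[fun ω => likelihoodProcess O XL y t ω • XL t ω |
      observationSigma P y t]) :=
    (stronglyMeasurable_condExp.mono (observationSigma_le hy t)).measurable
  exact h1.inv.smul h2

theorem measurable_trueFilter (hy : ∀ t, Measurable (y t)) (t : ℕ) :
    Measurable (trueFilter P X y t) :=
  (stronglyMeasurable_condExp.mono (observationSigma_le hy t)).measurable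

/-- By Egorov's theorem, almost sure convergence of the approximate filters is uniform outside an
event of arbitrarily small probability. -/
theorem filterConvergence_of_ae_tendsto [IsProbabilityMeasure P] {XL : ℕ → ℕ → Ω → Vec M}
    (hy : ∀ t, Measurable (y t)) (T : ℕ)
    (h : ∀ t, ∀ᵐ ω ∂P, Tendsto (fun L => approxFilter P O X y (XL L) t ω) atTop
      (𝓝 (trueFilter P X y t ω))) :
    FilterConvergence P O X y XL T := by
  intro C _
  -- Egorov's theorem needs only that the permitted exceptional probability is positive.
  have hε : 0 < ((T : ℝ) + 1) ^ (1 - C * (N : ℝ)) * Real.exp (-(C * (N : ℝ))) := by positivity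
  -- Summing the errors over the horizon lets a single exceptional set serve all times.
  let err : ℕ → Ω → ℝ := fun L ω => ∑ t ∈ Finset.range (T + 1),
    l1Norm (approxFilter P O X y (XL L) t ω - trueFilter P X y t ω)
  have herr : ∀ L, StronglyMeasurable (err L) := fun L =>
    (Finset.measurable_fun_sum _ fun t _ => continuous_l1Norm.measurable.comp
      ((measurable_approxFilter hy t).sub (measurable_trueFilter hy t))).stronglyMeasurable
  have hlim : ∀ᵐ ω ∂P, Tendsto (fun L => err L ω) atTop (𝓝 ((0 : Ω → ℝ) ω)) := by
    filter_upwards [ae_all_iff.2 h] with ω hω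
    have : Tendsto (fun L => err L ω) atTop (𝓝 (∑ _t ∈ Finset.range (T + 1), (0 : ℝ))) := by
      refine tendsto_finsetSum _ fun t _ => ?_
      have h1 : Tendsto (fun L => approxFilter P O X y (XL L) t ω - trueFilter P X y t ω) atTop
          (𝓝 0) := by
        simpa using (hω t).sub_const (trueFilter P X y t ω)
      simpa [l1Norm_zero, Function.comp_def] using (continuous_l1Norm.tendsto (0 : Vec M)).comp h1
    simpa using this
  obtain ⟨s, hs, hPs, hunif⟩ :=
    tendstoUniformlyOn_of_ae_tendsto' herr stronglyMeasurable_zero hlim hε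
  refine ⟨sᶜ, hs.compl, ?_, ?_⟩
  · rw [prob_compl_eq_one_sub hs, ENNReal.ofReal_sub _ hε.le, ENNReal.ofReal_one]
    exact tsub_le_tsub_left hPs 1
  · rw [ENNReal.tendsto_nhds_zero]
    intro ε hε
    rcases eq_or_ne ε ⊤ with rfl | hεtop
    · simp
    filter_upwards [Metric.tendstoUniformlyOn_iff.1 hunif ε.toReal
      (ENNReal.toReal_pos hε.ne' hεtop)] with L hL
    refine iSup₂_le fun t ht => iSup₂_le fun ω hω => ?_
    refine ENNReal.ofReal_le_of_le_toReal (le_trans ?_ (hL ω hω).le)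
    rw [Pi.zero_apply, dist_zero_left, Real.norm_eq_abs]
    refine le_trans ?_ (le_abs_self _)
    exact Finset.single_le_sum
      (f := fun t => l1Norm (approxFilter P O X y (XL L) t ω - trueFilter P X y t ω))
      (fun _ _ => l1Norm_nonneg _) (Finset.mem_range.2 (Nat.lt_succ_of_le ht))

theorem filterConvergence_of_isApproximation [IsProbabilityMeasure P] {XL : ℕ → ℕ → Ω → Vec M}
    (hXL : IsApproximation P (stateCube M a b) X fun L => XL (L + 1))
    (hO : O.IsRegular (stateCube M a b)) (hX : ∀ t, Measurable (X t))
    (hXZ : ∀ t, ∀ᵐ ω ∂P, X t ω ∈ stateCube M a b) (hy : ∀ t, Measurable (y t)) (T : ℕ) :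
    FilterConvergence P O X y XL T :=
  filterConvergence_of_ae_tendsto hy T fun t =>
    (hXL.ae_tendsto_approxFilter hO hX hXZ hy t).mono fun _ hω =>
      (tendsto_add_atTop_iff_nat 1).1 hω

end Filters

end GridFilter

/-! ### The convergence theorem for both quantizations -/

theorem theorem2 {Ω : Type*} [MeasurableSpace Ω] (P : Measure Ω) [IsProbabilityMeasure P]
    {M N : ℕ} {a b : ℝ} (hab : a < b)
    (O : GridFilter.ObservationModel M N) (hO : O.IsRegular (GridFilter.stateCube M a b))
    (Xinit : Ω → GridFilter.Vec M) (X : ℕ → Ω → GridFilter.Vec M) (y : ℕ → Ω → GridFilter.Vec N)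
    (cell : (L : ℕ) → Fin L → Set ℝ)
    (hcell : ∀ L, 1 ≤ L → GridFilter.IsUniformPartition a b L (cell L))
    (T : ℕ) :
    (∀ (K : ℕ → Kernel (GridFilter.Vec M) (GridFilter.Vec M)), (∀ t, IsMarkovKernel (K t)) →
      GridFilter.IsHiddenMarkovModel P (GridFilter.stateCube M a b) O K Xinit X y →
      GridFilter.FilterConvergence P O X y
        (fun L => GridFilter.marginalQuantization (GridFilter.quantizer a b (cell L)) X) T) ∧
    (∀ {MW : ℕ} (𝒲 : Set (GridFilter.Vec MW))
      (f : ℕ → GridFilter.Vec M → GridFilter.Vec MW → GridFilter.Vec M)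
      (W : ℕ → Ω → GridFilter.Vec MW),
      GridFilter.IsStateSpaceModel P (GridFilter.stateCube M a b) 𝒲 O f Xinit W X y →
      GridFilter.IsLipschitzTransition (GridFilter.stateCube M a b) 𝒲 f →
      GridFilter.FilterConvergence P O X y
        (fun L => GridFilter.markovianQuantization (GridFilter.quantizer a b (cell L)) f Xinit W)
        T) := by
  refine ⟨fun K _ h => ?_, fun {MW} 𝒲 f W h hf => ?_⟩
  · exact GridFilter.filterConvergence_of_isApproximation
      (GridFilter.isApproximation_marginalQuantization hab.le h.measurable_state h.state_mem hcell)
      hO h.measurable_state h.state_mem h.measurable_obs T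
  · exact GridFilter.filterConvergence_of_isApproximation
      (h.isApproximation_markovianQuantization hf hab.le hcell)
      hO h.measurable_state h.state_mem h.measurable_obs T
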